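/- **Setting.** Let $f\colon\mathbb R^n\to\mathbb R$ be locally Lipschitz continuous, let $F\colon\mathbb R^n\rightrightarrows\mathbb R^m$ and $G\colon\mathbb R^n\times\mathbb R^m\rightrightarrows\mathbb R^s$ be set-valued mappings with closed graphs, and let $M\subset\mathbb R^n$ be nonempty and closed. Put $H(z):=\bigcup_{\lambda\in F(z)}G(z,\lambda)$ and consider the program $$\text{(P)}\qquad \min_z\ f(z)\quad\text{s.t.}\quad 0\in H(z),\ z\in M .$$ Let $K(z):=\{\lambda\in F(z)\mid 0\in G(z,\lambda)\}$ and define, with $\operatorname{gph}$ denoting the graph, $$\mathcal H(z,\lambda):=(F(z)-\lambda)\times G(z,\lambda),\qquad \mathfrak H(z,\lambda):=\bigl((z,\lambda)-\operatorname{gph}F\bigr)\times\bigl((z,\lambda,0)-\operatorname{gph}G\bigr),$$ $$H_M(z):=H(z)\times(z-M),\quad \mathcal H_M(z,\lambda):=\mathcal H(z,\lambda)\times(z-M),\quad \mathfrak H_M(z,\lambda):=\mathfrak H(z,\lambda)\times(z-M).$$ **Notions.** A set-valued mapping $\Upsilon$ is metrically subregular at $(\bar z,\bar w)\in\operatorname{gph}\Upsilon$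 if there are $\kappa>0$ and a neighborhood $U$ of $\bar z$ with $\operatorname{dist}(z,\Upsilon^{-1}(\bar w))\le\kappa\operatorname{dist}(\bar w,\Upsilon(z))$ for all $z\in U$, where $\Upsilon^{-1}(\bar w)=\{z\mid\bar w\in\Upsilon(z)\}$ and $\operatorname{dist}(\cdot,\varnothing)=\infty$. For a set $A$ and $\bar z\in A$, let $\mathcal T_A(\bar z)$ be the set of all $d$ for which there are $z_k\in A$, $z_k\to\bar z$, and $t_k\downarrow0$ with $(z_k-\bar z)/t_k\to d$; let $\widehat{\mathcal N}_A(\bar z):=\{\xi\mid\xi^\top d\le0\ \forall d\in\mathcal T_A(\bar z)\}$, and let $\mathcal N_A(\bar z)$ be the set of all limits of sequences $\xi_k\in\widehat{\mathcal N}_A(z_k)$ with $z_k\in A$, $z_k\to\bar z$. Moreover, $\partial f(\bar z):=\{\xi\mid(\xi,-1)\in\mathcal N_{\operatorname{epi}f}(\bar z,f(\bar z))\}$, where $\operatorname{epi}f:=\{(z,t)\mid t\ge f(z)\}$, and $D^*\Upsilon(\bar z,\bar w)(\eta):=\{\xi\mid(\xi,-\eta)\in\mathcal N_{\operatorname{gph}\Upsilon}(\bar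 z,\bar w)\}$. A feasible point $\bar z$ of (P) is called * *implicitly M-stationary* if there is $\nu\in\mathbb R^s$ with $0\in\partial f(\bar z)+D^*H(\bar z,0)(\nu)+\mathcal N_M(\bar z)$; * *fuzzily M-stationary w.r.t.* $\bar\lambda\in K(\bar z)$ if there are $\mu\in\mathbb R^m$, $\nu\in\mathbb R^s$ with $(0,0)\in\partial f(\bar z)\times\{0\}+D^*\mathcal H((\bar z,\bar\lambda),(0,0))(\mu,\nu)+\mathcal N_M(\bar z)\times\{0\}$; * *explicitly M-stationary w.r.t.* $\bar\lambda\in K(\bar z)$ if there are $\mu\in\mathbb R^m$, $\nu\in\mathbb R^s$ with $0\in\partial f(\bar z)+D^*F(\bar z,\bar\lambda)(\mu)+\{\xi\in\mathbb R^n\mid(\xi,\mu)\in D^*G((\bar z,\bar\lambda),0)(\nu)\}+\mathcal N_M(\bar z)$. **Proposition.** Let $\bar z$ be a local minimizer of (P). * (a) If $\operatorname{gph}H$ is locally closed around $(\bar z,0)$ and $H_M$ is metrically subregular at $(\bar z,(0,0))$, then $\bar z$ is implicitly M-stationary. * (b) If $\bar\lambda\in K(\bar z)$ and $\mathcal H_M$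 is metrically subregular at $((\bar z,\bar\lambda),(0,0,0))$, then $\bar z$ is fuzzily M-stationary w.r.t. $\bar\lambda$. * (c) If $\bar\lambda\in K(\bar z)$ and $\mathfrak H_M$ is metrically subregular at $((\bar z,\bar\lambda),((0,0),(0,0,0),0))$, then $\bar z$ is explicitly M-stationary w.r.t. $\bar\lambda$. -/

import Mathlib

open Filter Topology
open scoped Pointwise NNReal ENNReal

/-! ## Products of Euclidean spaces

The product of two Euclidean spaces is `WithLp 2 (E × F)`, so that it carries the inner product
`⟪(x, y), (x', y')⟫ = ⟪x, x'⟫ + ⟪y, y'⟫`. Its norm is equivalent to the sum norm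
`‖x‖ + ‖y‖`, so convergence, closedness and metric subregularity (whose constant is only required
to exist) are the same for both norms. -/

/-- The Euclidean product of `E` and `F`. -/
abbrev EProd (E F : Type*) : Type _ := WithLp 2 (E × F)

/-- The pair `(x, y)` as an element of the Euclidean product. -/
abbrev pair {E F : Type*} (x : E) (y : F) : EProd E F := WithLp.toLp 2 (x, y)

/-- The product set `A × B`. -/
def setProd {E F : Type*} (A : Set E) (B : Set F) : Set (EProd E F) :=
  {p | p.fst ∈ A ∧ p.snd ∈ B}

/-! ## Set-valued mappings -/

/-- The graph of a set-valued mapping. -/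
def gph {E F : Type*} (Υ : E → Set F) : Set (EProd E F) :=
  {p | p.snd ∈ Υ p.fst}

/-- The inverse of a set-valued mapping. -/
def svInv {E F : Type*} (Υ : E → Set F) (w : F) : Set E :=
  {z | w ∈ Υ z}

/-- `Υ` is metrically subregular at `(zbar, wbar)`: there are `κ > 0` and a neighbourhood `U` of
`zbar` with `dist (z, Υ⁻¹(wbar)) ≤ κ dist (wbar, Υ(z))` for all `z ∈ U`. The distances are
extended-valued, so the distance to the empty set is `∞`. -/
def MetricallySubregularAt {E F : Type*} [PseudoEMetricSpace E] [PseudoEMetricSpace F]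
    (Υ : E → Set F) (zbar : E) (wbar : F) : Prop :=
  ∃ κ : ℝ≥0, 0 < κ ∧ ∃ U ∈ 𝓝 zbar, ∀ z ∈ U,
    Metric.infEDist z (svInv Υ wbar) ≤ (κ : ℝ≥0∞) * Metric.infEDist wbar (Υ z)

/-- The set `A` is locally closed around the point `a`. -/
def LocallyClosedAround {E : Type*} [TopologicalSpace E] (A : Set E) (a : E) : Prop :=
  ∃ U ∈ 𝓝 a, IsClosed U ∧ IsClosed (A ∩ U)

/-! ## Variational analysis -/

section VariationalAnalysis

/-- The (Bouligand) tangent cone to `A` at `zbar`. -/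
def bouligandCone {E : Type*} [NormedAddCommGroup E] [InnerProductSpace ℝ E]
    (A : Set E) (zbar : E) : Set E :=
  {d | ∃ (z : ℕ → E) (t : ℕ → ℝ), (∀ k, z k ∈ A) ∧ (∀ k, 0 < t k) ∧
    Tendsto z atTop (𝓝 zbar) ∧ Tendsto t atTop (𝓝 0) ∧
    Tendsto (fun k => (t k)⁻¹ • (z k - zbar)) atTop (𝓝 d)}

/-- The polar cone `A° = {ξ | ⟪ξ, a⟫ ≤ 0 for all a ∈ A}`. -/
def polarCone {E : Type*} [NormedAddCommGroup E] [InnerProductSpace ℝ E]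
    (A : Set E) : Set E :=
  {ξ | ∀ a ∈ A, inner ℝ ξ a ≤ 0}

/-- The regular (Fréchet) normal cone to `A` at `zbar`. -/
def regularNormalCone {E : Type*} [NormedAddCommGroup E] [InnerProductSpace ℝ E]
    (A : Set E) (zbar : E) : Set E :=
  polarCone (bouligandCone A zbar)

/-- The limiting (Mordukhovich) normal cone to `A` at `zbar`. -/
def limitingNormalCone {E : Type*} [NormedAddCommGroup E] [InnerProductSpace ℝ E]
    (A : Set E) (zbar : E) : Set E :=
  {ξ | ∃ (z ξs : ℕ → E), (∀ k, z k ∈ A) ∧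
    Tendsto z atTop (𝓝 zbar) ∧ Tendsto ξs atTop (𝓝 ξ) ∧
    ∀ k, ξs k ∈ regularNormalCone A (z k)}

/-- The epigraph of a real-valued function. -/
def epigraph {E : Type*} (φ : E → ℝ) : Set (EProd E ℝ) :=
  {p | φ p.fst ≤ p.snd}

/-- The limiting subdifferential of `φ` at `zbar`. -/
def limitingSubdiff {E : Type*} [NormedAddCommGroup E] [InnerProductSpace ℝ E]
    (φ : E → ℝ) (zbar : E) : Set E :=
  {ξ | pair ξ (-1 : ℝ) ∈ limitingNormalCone (epigraph φ) (pair zbar (φ zbar))}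

/-- The limiting coderivative `D*Υ(zbar, wbar)(η)`. -/
def coderiv {E F : Type*} [NormedAddCommGroup E] [InnerProductSpace ℝ E]
    [NormedAddCommGroup F] [InnerProductSpace ℝ F]
    (Υ : E → Set F) (zbar : E) (wbar : F) (η : F) : Set E :=
  {ξ | pair ξ (-η) ∈ limitingNormalCone (gph Υ) (pair zbar wbar)}

end VariationalAnalysis

/-! ## The program with implicit variables

`X = ℝⁿ` is the space of the decision variable `z`, `L = ℝᵐ` that of the implicit variable `λ`
(written `l`), and `S = ℝˢ` the image space of `G`. -/

/-- `H(z) = ⋃_{l ∈ F(z)} G(z, l)`. -/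
def mapH {X L S : Type*} (F : X → Set L) (G : EProd X L → Set S) (z : X) : Set S :=
  ⋃ l ∈ F z, G (pair z l)

/-- The feasible set `Z = {z ∈ M | 0 ∈ H(z)}` of the program
`min f(z)` subject to `0 ∈ H(z)`, `z ∈ M`. -/
def feasibleSet {X L S : Type*} [Zero S] (F : X → Set L) (G : EProd X L → Set S) (M : Set X) :
    Set X :=
  {z | 0 ∈ mapH F G z ∧ z ∈ M}

/-- `zbar` is a local minimizer of the program `min f(z)` subject to `0 ∈ H(z)`, `z ∈ M`. -/
def IsLocalMinimizer {X L S : Type*} [TopologicalSpace X] [Zero S] (f : X → ℝ)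
    (F : X → Set L) (G : EProd X L → Set S) (M : Set X) (zbar : X) : Prop :=
  zbar ∈ feasibleSet F G M ∧ IsLocalMinOn f (feasibleSet F G M) zbar

/-- The intermediate mapping `K(z) = {l ∈ F(z) | 0 ∈ G(z, l)}`. -/
def mapK {X L S : Type*} [Zero S] (F : X → Set L) (G : EProd X L → Set S) (z : X) : Set L :=
  {l | l ∈ F z ∧ 0 ∈ G (pair z l)}

/-- The mapping `𝓗(z, l) = (F(z) - l) × G(z, l)`. -/
def mapCalH {X L S : Type*} [AddCommGroup L] (F : X → Set L) (G : EProd X L → Set S)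
    (p : EProd X L) : Set (EProd L S) :=
  setProd (F p.fst - {p.snd}) (G p)

/-- The mapping `𝔥(z, l) = ((z, l) - gph F) × ((z, l, 0) - gph G)`. -/
def mapFrakH {X L S : Type*} [AddCommGroup X] [AddCommGroup L] [AddCommGroup S]
    (F : X → Set L) (G : EProd X L → Set S) (p : EProd X L) :
    Set (EProd (EProd X L) (EProd (EProd X L) S)) :=
  setProd ({p} - gph F) ({pair p (0 : S)} - gph G)

/-- `H_M(z) = H(z) × (z - M)`. -/
def mapHM {X L S : Type*} [AddCommGroup X] (F : X → Set L) (G : EProd X L → Set S) (M : Set X)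
    (z : X) : Set (EProd S X) :=
  setProd (mapH F G z) ({z} - M)

/-- `𝓗_M(z, l) = 𝓗(z, l) × (z - M)`. -/
def mapCalHM {X L S : Type*} [AddCommGroup X] [AddCommGroup L]
    (F : X → Set L) (G : EProd X L → Set S) (M : Set X) (p : EProd X L) :
    Set (EProd (EProd L S) X) :=
  setProd (mapCalH F G p) ({p.fst} - M)

/-- `𝔥_M(z, l) = 𝔥(z, l) × (z - M)`. -/
def mapFrakHM {X L S : Type*} [AddCommGroup X] [AddCommGroup L] [AddCommGroup S]
    (F : X → Set L) (G : EProd X L → Set S) (M : Set X) (p : EProd X L) :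
    Set (EProd (EProd (EProd X L) (EProd (EProd X L) S)) X) :=
  setProd (mapFrakH F G p) ({p.fst} - M)

/-- The feasible point `zbar` is implicitly M-stationary. -/
def ImplicitlyMStationary {X L S : Type*}
    [NormedAddCommGroup X] [InnerProductSpace ℝ X]
    [NormedAddCommGroup S] [InnerProductSpace ℝ S]
    (f : X → ℝ) (F : X → Set L) (G : EProd X L → Set S) (M : Set X) (zbar : X) : Prop :=
  zbar ∈ feasibleSet F G M ∧ ∃ ν : S,
    (0 : X) ∈ limitingSubdiff f zbar + coderiv (mapH F G) zbar 0 ν + limitingNormalCone M zbar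

/-- The feasible point `zbar` is fuzzily M-stationary with respect to `lbar ∈ K(zbar)`. -/
def FuzzilyMStationary {X L S : Type*}
    [NormedAddCommGroup X] [InnerProductSpace ℝ X]
    [NormedAddCommGroup L] [InnerProductSpace ℝ L]
    [NormedAddCommGroup S] [InnerProductSpace ℝ S]
    (f : X → ℝ) (F : X → Set L) (G : EProd X L → Set S) (M : Set X)
    (zbar : X) (lbar : L) : Prop :=
  zbar ∈ feasibleSet F G M ∧ lbar ∈ mapK F G zbar ∧ ∃ (μ : L) (ν : S),
    (pair 0 0 : EProd X L) ∈ setProd (limitingSubdiff f zbar) {0} +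
      coderiv (mapCalH F G) (pair zbar lbar) (pair 0 0) (pair μ ν) +
      setProd (limitingNormalCone M zbar) {0}

/-- The feasible point `zbar` is explicitly M-stationary with respect to `lbar ∈ K(zbar)`. -/
def ExplicitlyMStationary {X L S : Type*}
    [NormedAddCommGroup X] [InnerProductSpace ℝ X]
    [NormedAddCommGroup L] [InnerProductSpace ℝ L]
    [NormedAddCommGroup S] [InnerProductSpace ℝ S]
    (f : X → ℝ) (F : X → Set L) (G : EProd X L → Set S) (M : Set X)
    (zbar : X) (lbar : L) : Prop :=
  zbar ∈ feasibleSet F G M ∧ lbar ∈ mapK F G zbar ∧ ∃ (μ : L) (ν : S),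
    (0 : X) ∈ limitingSubdiff f zbar + coderiv F zbar lbar μ +
      {ξ : X | pair ξ μ ∈ coderiv G (pair zbar lbar) 0 ν} +
      limitingNormalCone M zbar

/-!
All three assertions follow from one multiplier rule (`exists_multipliers`) for the program
`min f (P e)` subject to `0 ∈ Υ e` and `Q e ∈ Ω`, with `P` and `Q` linear, `f` locally Lipschitz,
`gph Υ` locally closed and `Ω` closed. Implicit stationarity is the case `Υ = H`, `P = Q = id`,
`Ω = M`; fuzzy stationarity is the case `Υ = 𝓗`, `P = Q = ((z, l) ↦ z)`, `Ω = M`; explicit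
stationarity is the case `Υ = G`, `Q (z, l) = ((z, l), z)`, `Ω = gph F × M`.

Metric subregularity bounds the distance to the feasible set by the residual `‖w‖ + ‖Q e - y‖`
with `w ∈ Υ e`, `y ∈ Ω`, so the constraints can be replaced by an exact penalty
(`exists_exact_penalty`). Replacing `f` by its epigraph as well, a local minimizer minimizes the
linear function `t` plus a multiple of `‖(x - P e, w, Q e - y)‖` over independent points
`(x, t) ∈ epi f`, `(e, w) ∈ gph Υ`, `y ∈ Ω`. This is an instance of
`exists_limitingNormal_of_isLocalMinOn_add_norm`: a local minimizer `v₀` of `⟪c, v⟫ + C * ‖T v‖` on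
a locally closed set, with `T v₀ = 0`, has a limiting normal `-c - T* ζ`. To see this, smooth the
norm to `√(ε ^ 2 + ‖T v‖ ^ 2)`, add `‖v - v₀‖ ^ 2`, apply Fermat's rule at a minimizer, and let
`ε → 0`: the minimizers tend to `v₀`, and the multipliers are bounded by `C`. No sum rule for
subdifferentials or coderivatives is needed, since the normal cone of a product set splits
(`limitingNormalCone_setProd_subset`).
-/

/-! ### Tangents and normals -/

section Cones

variable {E F : Type*} [NormedAddCommGroup E] [InnerProductSpace ℝ E]
  [NormedAddCommGroup F] [InnerProductSpace ℝ F]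

theorem bouligandCone_subset_posTangentConeAt (A : Set E) (x : E) :
    bouligandCone A x ⊆ posTangentConeAt A x := by
  rintro d ⟨z, t, hzA, ht, hz, -, hd⟩
  refine mem_tangentConeAt_of_seq atTop (fun k => (⟨(t k)⁻¹, (inv_pos.2 (ht k)).le⟩ : ℝ≥0))
    (fun k => z k - x) ?_ (Eventually.of_forall fun k => by simpa using hzA k) ?_
  · simpa using hz.sub_const x
  · exact hd

/-- Fermat's rule: the negative gradient at a constrained minimizer is a regular normal. -/
theorem neg_mem_regularNormalCone_of_isLocalMinOn {A : Set E} {x : E} {g : E → ℝ}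
    {g' : E →L[ℝ] ℝ} {ξ : E} (hmin : IsLocalMinOn g A x) (hg : HasFDerivAt g g' x)
    (hξ : ∀ v, inner ℝ ξ v = -g' v) : ξ ∈ regularNormalCone A x := by
  intro d hd
  rw [hξ, neg_nonpos]
  exact hmin.hasFDerivWithinAt_nonneg hg.hasFDerivWithinAt
    (bouligandCone_subset_posTangentConeAt A x hd)

theorem fst_mem_regularNormalCone {A : Set E} {B : Set F} {p ξ : EProd E F}
    (hp : p ∈ setProd A B) (hξ : ξ ∈ regularNormalCone (setProd A B) p) :
    ξ.fst ∈ regularNormalCone A p.fst := by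
  rintro d ⟨z, t, hz, ht, hzlim, htlim, hd⟩
  have := hξ (pair d 0) ⟨fun k => pair (z k) p.snd, t, fun k => ⟨hz k, hp.2⟩, ht, ?_, htlim, ?_⟩
  · simpa [WithLp.prod_inner_apply] using this
  · exact ((WithLp.prod_continuous_toLp 2 E F).tendsto _).comp
      (hzlim.prodMk_nhds tendsto_const_nhds)
  · have h := ((WithLp.prod_continuous_toLp 2 E F).tendsto (d, 0)).comp
      (hd.prodMk_nhds (tendsto_const_nhds (x := (0 : F)) (f := atTop)))
    refine h.congr fun k => ?_
    apply (WithLp.equiv 2 (E × F)).injective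
    ext <;> simp

theorem snd_mem_regularNormalCone {A : Set E} {B : Set F} {p ξ : EProd E F}
    (hp : p ∈ setProd A B) (hξ : ξ ∈ regularNormalCone (setProd A B) p) :
    ξ.snd ∈ regularNormalCone B p.snd := by
  rintro d ⟨z, t, hz, ht, hzlim, htlim, hd⟩
  have := hξ (pair 0 d) ⟨fun k => pair p.fst (z k), t, fun k => ⟨hp.1, hz k⟩, ht, ?_, htlim, ?_⟩
  · simpa [WithLp.prod_inner_apply] using this
  · exact ((WithLp.prod_continuous_toLp 2 E F).tendsto _).comp
      (tendsto_const_nhds.prodMk_nhds hzlim)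
  · have h := ((WithLp.prod_continuous_toLp 2 E F).tendsto (0, d)).comp
      ((tendsto_const_nhds (x := (0 : E)) (f := atTop)).prodMk_nhds hd)
    refine h.congr fun k => ?_
    apply (WithLp.equiv 2 (E × F)).injective
    ext <;> simp

/-- The limiting normal cone of a product set lies in the product of the limiting normal cones. -/
theorem limitingNormalCone_setProd_subset (A : Set E) (B : Set F) (p : EProd E F) :
    limitingNormalCone (setProd A B) p ⊆
      setProd (limitingNormalCone A p.fst) (limitingNormalCone B p.snd) := by
  rintro ξ ⟨z, ξs, hz, hzlim, hξlim, hN⟩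
  have h1 : Continuous (WithLp.fst : EProd E F → E) := WithLp.continuous_fst 2 E F
  have h2 : Continuous (WithLp.snd : EProd E F → F) := WithLp.continuous_snd 2 E F
  exact ⟨⟨fun k => (z k).fst, fun k => (ξs k).fst, fun k => (hz k).1,
      (h1.tendsto _).comp hzlim, (h1.tendsto _).comp hξlim,
      fun k => fst_mem_regularNormalCone (hz k) (hN k)⟩,
    ⟨fun k => (z k).snd, fun k => (ξs k).snd, fun k => (hz k).2,
      (h2.tendsto _).comp hzlim, (h2.tendsto _).comp hξlim,
      fun k => snd_mem_regularNormalCone (hz k) (hN k)⟩⟩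

end Cones

/-! ### Local closedness -/

theorem IsClosed.locallyClosedAround {E : Type*} [TopologicalSpace E] {A : Set E}
    (hA : IsClosed A) (a : E) : LocallyClosedAround A a :=
  ⟨Set.univ, univ_mem, isClosed_univ, by simpa using hA⟩

section LocallyClosed

variable {E F : Type*} [TopologicalSpace E] [TopologicalSpace F]

theorem LocallyClosedAround.setProd {A : Set E} {B : Set F} {p : EProd E F}
    (hA : LocallyClosedAround A p.fst) (hB : LocallyClosedAround B p.snd) :
    LocallyClosedAround (setProd A B) p := by
  obtain ⟨U, hU, hUc, hAU⟩ := hA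
  obtain ⟨V, hV, hVc, hBV⟩ := hB
  have h1 : Continuous (WithLp.fst : EProd E F → E) := WithLp.continuous_fst 2 E F
  have h2 : Continuous (WithLp.snd : EProd E F → F) := WithLp.continuous_snd 2 E F
  refine ⟨WithLp.fst ⁻¹' U ∩ WithLp.snd ⁻¹' V,
    inter_mem (h1.continuousAt hU) (h2.continuousAt hV),
    (hUc.preimage h1).inter (hVc.preimage h2), ?_⟩
  have : _root_.setProd A B ∩ (WithLp.fst ⁻¹' U ∩ WithLp.snd ⁻¹' V) =
      WithLp.fst ⁻¹' (A ∩ U) ∩ WithLp.snd ⁻¹' (B ∩ V) := by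
    ext q
    simp only [_root_.setProd, Set.mem_inter_iff, Set.mem_ofPred_eq, Set.mem_preimage]
    tauto
  rw [this]
  exact (hAU.preimage h1).inter (hBV.preimage h2)

theorem isClosed_setProd {A : Set E} {B : Set F} (hA : IsClosed A) (hB : IsClosed B) :
    IsClosed (setProd A B) :=
  (hA.preimage (WithLp.continuous_fst 2 E F)).inter (hB.preimage (WithLp.continuous_snd 2 E F))

theorem isClosed_epigraph {f : E → ℝ} (hf : Continuous f) : IsClosed (epigraph f) :=
  isClosed_le (hf.comp (WithLp.continuous_fst 2 E ℝ)) (WithLp.continuous_snd 2 E ℝ)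

end LocallyClosed

/-! ### Multipliers for a norm penalty -/

section Penalty

variable {V W : Type*} [NormedAddCommGroup V] [InnerProductSpace ℝ V] [FiniteDimensional ℝ V]
  [NormedAddCommGroup W] [InnerProductSpace ℝ W] [FiniteDimensional ℝ W]

/-- Approximate stationarity: the penalty `C * ‖T v‖` is smoothed to `C * √(ε ^ 2 + ‖T v‖ ^ 2)` and
the proximal term `‖v - v₀‖ ^ 2` is added. The minimum of the resulting smooth function exceeds
`⟪c, v₀⟫` by at most `C * ε`, which forces its minimizers towards `v₀`. -/
theorem exists_regularNormal_near_of_isLocalMinOn_add_norm {A : Set V} {v₀ c : V} {C δ : ℝ}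
    {T : V →L[ℝ] W} (hA : LocallyClosedAround A v₀) (hv₀ : v₀ ∈ A) (hT : T v₀ = 0) (hC : 0 ≤ C)
    (hmin : IsLocalMinOn (fun v => inner ℝ c v + C * ‖T v‖) A v₀) (hδ : 0 < δ) :
    ∃ v ∈ A, ‖v - v₀‖ ≤ δ ∧ ∃ ζ : W, ‖ζ‖ ≤ C ∧ ∃ ξ ∈ regularNormalCone A v,
      ∀ u, inner ℝ ξ u = -inner ℝ c u - inner ℝ ζ (T u) - 2 * inner ℝ (v - v₀) u := by
  have : CompleteSpace V := FiniteDimensional.complete ℝ V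
  have : CompleteSpace W := FiniteDimensional.complete ℝ W
  have : ProperSpace V := FiniteDimensional.proper_real V
  obtain ⟨U, hU, -, hAU⟩ := hA
  have hmin' : ∀ᶠ v in 𝓝 v₀, v ∈ A → inner ℝ c v₀ + C * ‖T v₀‖ ≤ inner ℝ c v + C * ‖T v‖ :=
    eventually_nhdsWithin_iff.1 hmin
  obtain ⟨r, hr, hball⟩ := Metric.nhds_basis_closedBall.mem_iff.1 (inter_mem hU hmin')
  set ρ := min δ (r / 2) with hρ
  have hρ0 : 0 < ρ := lt_min hδ (by positivity)
  -- `ε` is chosen so that `C * ε ≤ ρ ^ 2`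
  set ε := ρ ^ 2 / (C + 1) with hε
  have hε0 : 0 < ε := by positivity
  have hCε : C * ε ≤ ρ ^ 2 := by
    rw [hε, mul_div_assoc', div_le_iff₀ (by positivity)]
    nlinarith [sq_nonneg ρ]
  set g : V → ℝ := fun v => inner ℝ c v + C * √(ε ^ 2 + ‖T v‖ ^ 2) + ‖v - v₀‖ ^ 2 with hgdef
  have hcomp : IsCompact (A ∩ Metric.closedBall v₀ r) := by
    have : A ∩ Metric.closedBall v₀ r = (A ∩ U) ∩ Metric.closedBall v₀ r := by
      ext v
      exact ⟨fun h => ⟨⟨h.1, (hball h.2).1⟩, h.2⟩, fun h => ⟨h.1.1, h.2⟩⟩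
    rw [this]
    exact (isCompact_closedBall v₀ r).inter_left hAU
  have hgc : Continuous g := by fun_prop
  obtain ⟨v, ⟨hvA, hvr⟩, hvmin⟩ := hcomp.exists_isMinOn
    ⟨v₀, hv₀, Metric.mem_closedBall_self hr.le⟩ hgc.continuousOn
  have hclose : ‖v - v₀‖ ≤ ρ := by
    have h1 : g v ≤ g v₀ := hvmin ⟨hv₀, Metric.mem_closedBall_self hr.le⟩
    have h2 := (hball hvr).2 hvA
    have h3 : ‖T v‖ ≤ √(ε ^ 2 + ‖T v‖ ^ 2) := Real.le_sqrt_of_sq_le (by nlinarith)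
    have h4 := mul_le_mul_of_nonneg_left h3 hC
    simp only [hgdef, hT, norm_zero, sub_self] at h1 h2
    rw [show ε ^ 2 + (0 : ℝ) ^ 2 = ε ^ 2 by ring, Real.sqrt_sq hε0.le] at h1
    exact le_of_sq_le_sq (by nlinarith) hρ0.le
  have hloc : IsLocalMinOn g A v := by
    have hnear : Metric.closedBall v₀ r ∈ 𝓝 v := by
      refine mem_of_superset (Metric.isOpen_ball.mem_nhds ?_) Metric.ball_subset_closedBall
      rw [Metric.mem_ball, dist_eq_norm]
      linarith [min_le_right δ (r / 2)]
    exact eventually_nhdsWithin_iff.2 (mem_of_superset hnear fun u hu huA => hvmin ⟨huA, hu⟩)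
  set q := √(ε ^ 2 + ‖T v‖ ^ 2) with hq
  have hq0 : 0 < q := Real.sqrt_pos.2 (by positivity)
  have hTq : ‖T v‖ ≤ q := Real.le_sqrt_of_sq_le (by nlinarith)
  set ζ : W := (C / q) • T v with hζ
  have hder : HasFDerivAt g (innerSL ℝ c + C • ((1 / (2 * q)) • (2 • (innerSL ℝ (T v)).comp T))
      + 2 • (innerSL ℝ (v - v₀)).comp (ContinuousLinearMap.id ℝ V)) v := by
    refine HasFDerivAt.add (HasFDerivAt.add (innerSL ℝ c).hasFDerivAt ?_) ?_
    · refine HasFDerivAt.const_mul (HasFDerivAt.sqrt ?_ (by positivity)) C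
      exact T.hasFDerivAt.norm_sq.const_add _
    · exact ((hasFDerivAt_id v).sub_const v₀).norm_sq
  refine ⟨v, hvA, hclose.trans (min_le_left _ _), ζ, ?_,
    -c - ContinuousLinearMap.adjoint T ζ - (2 : ℝ) • (v - v₀), ?_, fun u => ?_⟩
  · rw [hζ, norm_smul, Real.norm_of_nonneg (by positivity), div_mul_eq_mul_div,
      div_le_iff₀ hq0]
    exact mul_le_mul_of_nonneg_left hTq hC
  · refine neg_mem_regularNormalCone_of_isLocalMinOn hloc hder fun u => ?_
    rw [inner_sub_left, inner_sub_left, inner_neg_left, ContinuousLinearMap.adjoint_inner_left,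
      hζ, real_inner_smul_left, real_inner_smul_left]
    simp only [add_apply, smul_apply,
      ContinuousLinearMap.comp_apply, ContinuousLinearMap.id_apply, innerSL_apply_apply,
      smul_eq_mul, nsmul_eq_mul, Nat.cast_ofNat]
    field_simp
    ring
  · simp only [inner_sub_left, inner_neg_left, ContinuousLinearMap.adjoint_inner_left,
      real_inner_smul_left]

/-- A local minimizer `v₀` of `⟪c, ·⟫ + C * ‖T ·‖` on a locally closed set with `T v₀ = 0` admits a
multiplier `ζ` such that `-c - T* ζ` is a limiting normal at `v₀`. -/
theorem exists_limitingNormal_of_isLocalMinOn_add_norm {A : Set V} {v₀ c : V} {C : ℝ}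
    {T : V →L[ℝ] W} (hA : LocallyClosedAround A v₀) (hv₀ : v₀ ∈ A) (hT : T v₀ = 0) (hC : 0 ≤ C)
    (hmin : IsLocalMinOn (fun v => inner ℝ c v + C * ‖T v‖) A v₀) :
    ∃ ζ : W, ∃ ξ ∈ limitingNormalCone A v₀, ∀ u, inner ℝ ξ u = -inner ℝ c u - inner ℝ ζ (T u) := by
  have : CompleteSpace V := FiniteDimensional.complete ℝ V
  have : CompleteSpace W := FiniteDimensional.complete ℝ W
  have : ProperSpace W := FiniteDimensional.proper_real W
  choose v hvA hv ζ hζ ξ hξ hinner using fun k : ℕ =>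
    exists_regularNormal_near_of_isLocalMinOn_add_norm hA hv₀ hT hC hmin
      (Nat.one_div_pos_of_nat (α := ℝ) (n := k))
  have hvlim : Tendsto v atTop (𝓝 v₀) := tendsto_iff_norm_sub_tendsto_zero.2 <|
    squeeze_zero (fun _ => norm_nonneg _) hv tendsto_one_div_add_atTop_nhds_zero_nat
  obtain ⟨ζ₀, -, φ, hφ, hζlim⟩ := (isCompact_closedBall (0 : W) C).tendsto_subseq
    (x := ζ) fun k => by simpa using hζ k
  have hvφ := hvlim.comp hφ.tendsto_atTop
  have heq : ∀ k, ξ k = -c - ContinuousLinearMap.adjoint T (ζ k) - (2 : ℝ) • (v k - v₀) := by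
    refine fun k => ext_inner_right ℝ fun u => ?_
    simp only [hinner, inner_sub_left, inner_neg_left, ContinuousLinearMap.adjoint_inner_left,
      real_inner_smul_left]
  refine ⟨ζ₀, -c - ContinuousLinearMap.adjoint T ζ₀,
    ⟨v ∘ φ, ξ ∘ φ, fun k => hvA _, hvφ, ?_, fun k => hξ _⟩, fun u => ?_⟩
  · have h := (tendsto_const_nhds (x := -c)).sub
      (((ContinuousLinearMap.adjoint T).continuous.tendsto ζ₀).comp hζlim) |>.sub
      ((hvφ.sub_const v₀).const_smul (2 : ℝ))
    rw [sub_self, smul_zero, sub_zero] at h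
    exact h.congr fun k => (heq _).symm
  · rw [inner_sub_left, inner_neg_left, ContinuousLinearMap.adjoint_inner_left]

end Penalty

/-! ### Metric estimates in Euclidean products -/

section Metric

variable {X Y : Type*} [NormedAddCommGroup X] [NormedAddCommGroup Y]

theorem norm_fst_le_norm (p : EProd X Y) : ‖p.fst‖ ≤ ‖p‖ :=
  le_of_sq_le_sq (by rw [WithLp.prod_norm_sq_eq_of_L2]; nlinarith [sq_nonneg ‖p.snd‖])
    (norm_nonneg p)

theorem norm_snd_le_norm (p : EProd X Y) : ‖p.snd‖ ≤ ‖p‖ :=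
  le_of_sq_le_sq (by rw [WithLp.prod_norm_sq_eq_of_L2]; nlinarith [sq_nonneg ‖p.fst‖])
    (norm_nonneg p)

theorem edist_pair_le (x x' : X) (y y' : Y) :
    edist (pair x y) (pair x' y') ≤ edist x x' + edist y y' := by
  rw [edist_dist, edist_dist, edist_dist, ← ENNReal.ofReal_add dist_nonneg dist_nonneg]
  refine ENNReal.ofReal_le_ofReal (le_of_sq_le_sq ?_ (by positivity))
  rw [dist_eq_norm, dist_eq_norm, dist_eq_norm, WithLp.prod_norm_sq_eq_of_L2]
  change ‖x - x'‖ ^ 2 + ‖y - y'‖ ^ 2 ≤ _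
  nlinarith [norm_nonneg (x - x'), norm_nonneg (y - y')]

theorem edist_fst_le (p q : EProd X Y) : edist p.fst q.fst ≤ edist p q := by
  rw [edist_dist, edist_dist, dist_eq_norm, dist_eq_norm]
  exact ENNReal.ofReal_le_ofReal (norm_fst_le_norm (p - q))

theorem edist_snd_le (p q : EProd X Y) : edist p.snd q.snd ≤ edist p q := by
  rw [edist_dist, edist_dist, dist_eq_norm, dist_eq_norm]
  exact ENNReal.ofReal_le_ofReal (norm_snd_le_norm (p - q))

end Metric

/-! ### Exact penalization -/

section ExactPenalty

variable {E W Y : Type*} [NormedAddCommGroup E] [NormedAddCommGroup W] [NormedAddCommGroup Y]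

/-- Clarke's exact penalty principle: a local error bound for the constraint system
`0 ∈ Υ e`, `Q e ∈ Ω` turns a constrained local minimizer of a locally Lipschitz function into a
local minimizer of a penalized function in which all constraints are decoupled. -/
theorem exists_exact_penalty {g : E → ℝ} (hg : LocallyLipschitz g) {Υ : E → Set W} {Q : E → Y}
    {Ω : Set Y} {e₀ : E} (he₀ : 0 ∈ Υ e₀ ∧ Q e₀ ∈ Ω)
    (hmin : IsLocalMinOn g {e | 0 ∈ Υ e ∧ Q e ∈ Ω} e₀) {κ : ℝ≥0}
    (hκ : ∀ᶠ e in 𝓝 e₀, ∀ w ∈ Υ e, ∀ y ∈ Ω,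
      Metric.infEDist e {e | 0 ∈ Υ e ∧ Q e ∈ Ω} ≤ κ * (edist 0 w + edist (Q e) y)) :
    ∃ C : ℝ, 0 ≤ C ∧ ∀ᶠ e in 𝓝 e₀, ∀ w ∈ Υ e, ∀ y ∈ Ω,
      g e₀ ≤ g e + C * (‖w‖ + ‖Q e - y‖) := by
  obtain ⟨K, t, ht, hLip⟩ := hg e₀
  obtain ⟨r, hr, hball⟩ := Metric.nhds_basis_ball.mem_iff.1
    (inter_mem ht (eventually_nhdsWithin_iff.1 hmin))
  refine ⟨K * κ, by positivity, ?_⟩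
  filter_upwards [hκ, Metric.ball_mem_nhds e₀ (half_pos hr)] with e he her w hw y hy
  rw [Metric.mem_ball] at her
  set D : ℝ := κ * (‖w‖ + ‖Q e - y‖) with hD
  have hD0 : 0 ≤ D := by positivity
  have hinf : Metric.infEDist e {e | 0 ∈ Υ e ∧ Q e ∈ Ω} ≤ ENNReal.ofReal D := by
    refine (he w hw y hy).trans_eq ?_
    rw [hD, ENNReal.ofReal_mul κ.coe_nonneg, ENNReal.ofReal_coe_nnreal,
      ENNReal.ofReal_add (norm_nonneg _) (norm_nonneg _), edist_dist, edist_dist, dist_zero_left,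
      dist_eq_norm]
  -- The infimal distance need not be attained, so an error `δ` is carried along.
  refine le_of_forall_pos_le_add fun δ hδ => ?_
  set δ' := δ / (K + 1) with hδ'
  have hδ'0 : 0 < δ' := by positivity
  have hKδ : K * δ' ≤ δ := by
    rw [hδ', mul_div_assoc', div_le_iff₀ (by positivity)]
    nlinarith
  have hlt : Metric.infEDist e {e | 0 ∈ Υ e ∧ Q e ∈ Ω} <
      min (ENNReal.ofReal (D + δ')) (ENNReal.ofReal (r / 2)) := by
    refine lt_min (hinf.trans_lt ?_) ((Metric.infEDist_le_edist_of_mem (y := e₀) he₀).trans_lt ?_)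
    · exact (ENNReal.ofReal_lt_ofReal_iff (by positivity)).2 (by linarith)
    · rw [edist_dist]
      exact (ENNReal.ofReal_lt_ofReal_iff (by positivity)).2 her
  obtain ⟨e', he', hee'⟩ := Metric.infEDist_lt_iff.1 hlt
  rw [edist_dist, lt_min_iff, ENNReal.ofReal_lt_ofReal_iff (by positivity),
    ENNReal.ofReal_lt_ofReal_iff (by positivity)] at hee'
  have he'r : e' ∈ Metric.ball e₀ r := by
    rw [Metric.mem_ball]
    linarith [dist_triangle_left e' e₀ e]
  have h1 : g e₀ ≤ g e' := (hball he'r).2 he'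
  have h2 := hLip.dist_le_mul e' (hball he'r).1 e
    (hball (Metric.ball_subset_ball (by linarith) her)).1
  have h3 : g e' - g e ≤ dist (g e') (g e) := le_abs_self _
  rw [dist_comm e' e] at h2
  have h4 : K * dist e e' ≤ K * (D + δ') := by gcongr; exact hee'.1.le
  linarith [show K * κ * (‖w‖ + ‖Q e - y‖) = K * D by rw [hD]; ring]

end ExactPenalty

/-! ### A multiplier rule for composite programs -/

section Composite

variable {X E W Y : Type*}
  [NormedAddCommGroup X] [InnerProductSpace ℝ X] [NormedAddCommGroup E] [InnerProductSpace ℝ E]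
  [NormedAddCommGroup W] [InnerProductSpace ℝ W] [NormedAddCommGroup Y] [InnerProductSpace ℝ Y]

/-- The continuous linear map `v ↦ (A v, B v)` into the Euclidean product. -/
def pairL {V : Type*} [NormedAddCommGroup V] [InnerProductSpace ℝ V] (A : V →L[ℝ] X)
    (B : V →L[ℝ] Y) : V →L[ℝ] EProd X Y :=
  (WithLp.prodContinuousLinearEquiv 2 ℝ X Y).symm.toContinuousLinearMap.comp (A.prod B)

@[simp]
theorem pairL_apply {V : Type*} [NormedAddCommGroup V] [InnerProductSpace ℝ V] (A : V →L[ℝ] X)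
    (B : V →L[ℝ] Y) (v : V) : pairL A B v = pair (A v) (B v) := rfl

/-- The multiplier rule for the program `min f (P e)` subject to `0 ∈ Υ e`, `Q e ∈ Ω` under an
error bound. After exact penalization, the points of `epi f`, `gph Υ` and `Ω` are independent
variables `((x, t), (e, w), y)`, coupled only by the penalty on `(x - P e, w, Q e - y)`. -/
theorem exists_multipliers [FiniteDimensional ℝ X] [FiniteDimensional ℝ E] [FiniteDimensional ℝ W]
    [FiniteDimensional ℝ Y] {f : X → ℝ} (hf : LocallyLipschitz f) (P : E →L[ℝ] X) (Q : E →L[ℝ] Y)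
    {Υ : E → Set W} {Ω : Set Y} {e₀ : E} (hΥ : LocallyClosedAround (gph Υ) (pair e₀ 0))
    (hΩ : IsClosed Ω) (he₀ : 0 ∈ Υ e₀ ∧ Q e₀ ∈ Ω)
    (hmin : IsLocalMinOn (fun e => f (P e)) {e | 0 ∈ Υ e ∧ Q e ∈ Ω} e₀) {κ : ℝ≥0}
    (hκ : ∀ᶠ e in 𝓝 e₀, ∀ w ∈ Υ e, ∀ y ∈ Ω,
      Metric.infEDist e {e | 0 ∈ Υ e ∧ Q e ∈ Ω} ≤ κ * (edist 0 w + edist (Q e) y)) :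
    ∃ ξ ∈ limitingSubdiff f (P e₀), ∃ ν : W, ∃ θ ∈ coderiv Υ e₀ 0 ν,
      ∃ η ∈ limitingNormalCone Ω (Q e₀),
        ∀ e, inner ℝ ξ (P e) + inner ℝ θ e + inner ℝ η (Q e) = 0 := by
  obtain ⟨C, hC, hpen⟩ :=
    exists_exact_penalty (hf.comp P.lipschitz.locallyLipschitz) he₀ hmin hκ
  obtain ⟨K, t, ht, hLip⟩ := hf (P e₀)
  let v₀ : EProd (EProd X ℝ) (EProd (EProd E W) Y) :=
    pair (pair (P e₀) (f (P e₀))) (pair (pair e₀ 0) (Q e₀))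
  let A : Set (EProd (EProd X ℝ) (EProd (EProd E W) Y)) := setProd (epigraph f) (setProd (gph Υ) Ω)
  let c : EProd (EProd X ℝ) (EProd (EProd E W) Y) := pair (pair 0 1) 0
  let πX : EProd (EProd X ℝ) (EProd (EProd E W) Y) →L[ℝ] X :=
    (WithLp.fstL 2 ℝ X ℝ).comp (WithLp.fstL 2 ℝ (EProd X ℝ) (EProd (EProd E W) Y))
  let πG : EProd (EProd X ℝ) (EProd (EProd E W) Y) →L[ℝ] EProd E W :=
    (WithLp.fstL 2 ℝ (EProd E W) Y).comp (WithLp.sndL 2 ℝ (EProd X ℝ) (EProd (EProd E W) Y))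
  let πE : EProd (EProd X ℝ) (EProd (EProd E W) Y) →L[ℝ] E := (WithLp.fstL 2 ℝ E W).comp πG
  let πW : EProd (EProd X ℝ) (EProd (EProd E W) Y) →L[ℝ] W := (WithLp.sndL 2 ℝ E W).comp πG
  let πY : EProd (EProd X ℝ) (EProd (EProd E W) Y) →L[ℝ] Y :=
    (WithLp.sndL 2 ℝ (EProd E W) Y).comp
      (WithLp.sndL 2 ℝ (EProd X ℝ) (EProd (EProd E W) Y))
  let T : EProd (EProd X ℝ) (EProd (EProd E W) Y) →L[ℝ] EProd X (EProd W Y) :=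
    pairL (πX - P.comp πE) (pairL πW (Q.comp πE - πY))
  have hTv (v : EProd (EProd X ℝ) (EProd (EProd E W) Y)) : T v = pair (v.fst.fst - P v.snd.fst.fst)
      (pair v.snd.fst.snd (Q v.snd.fst.fst - v.snd.snd)) := rfl
  have hcv (v : EProd (EProd X ℝ) (EProd (EProd E W) Y)) : inner ℝ c v = v.fst.snd := by
    simp [c, WithLp.prod_inner_apply]
  have hA : LocallyClosedAround A v₀ :=
    ((isClosed_epigraph hf.continuous).locallyClosedAround _).setProd
      (LocallyClosedAround.setProd hΥ (hΩ.locallyClosedAround _))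
  have hv₀ : v₀ ∈ A := ⟨le_refl (f (P e₀)), he₀⟩
  have hT₀ : T v₀ = 0 := by
    rw [hTv]
    change pair (P e₀ - P e₀) (pair 0 (Q e₀ - Q e₀)) = 0
    rw [sub_self, sub_self]
    rfl
  have hminA : IsLocalMinOn (fun v => inner ℝ c v + (K + 2 * C) * ‖T v‖) A v₀ := by
    refine eventually_nhdsWithin_iff.2 ?_
    have hE : Tendsto (fun v : EProd (EProd X ℝ) (EProd (EProd E W) Y) => v.snd.fst.fst)
        (𝓝 v₀) (𝓝 e₀) := πE.continuous.tendsto v₀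
    have hX : Tendsto (fun v : EProd (EProd X ℝ) (EProd (EProd E W) Y) => v.fst.fst)
        (𝓝 v₀) (𝓝 (P e₀)) := πX.continuous.tendsto v₀
    have hP : Tendsto (fun v : EProd (EProd X ℝ) (EProd (EProd E W) Y) => P v.snd.fst.fst)
        (𝓝 v₀) (𝓝 (P e₀)) := (P.continuous.tendsto e₀).comp hE
    filter_upwards [hE hpen, hX ht, hP ht] with v hv hxt hPt hvA
    have h1 : f (P e₀) ≤ f (P v.snd.fst.fst) +
        C * (‖v.snd.fst.snd‖ + ‖Q v.snd.fst.fst - v.snd.snd‖) := hv _ hvA.2.1 _ hvA.2.2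
    have h2 := hLip.dist_le_mul _ hPt _ hxt
    have h3 : f (P v.snd.fst.fst) - f v.fst.fst ≤ dist (f (P v.snd.fst.fst)) (f v.fst.fst) :=
      le_abs_self _
    have h4 : f v.fst.fst ≤ v.fst.snd := hvA.1
    have h5 : ‖v.fst.fst - P v.snd.fst.fst‖ ≤ ‖T v‖ := norm_fst_le_norm (T v)
    have h6 : ‖v.snd.fst.snd‖ ≤ ‖T v‖ :=
      (norm_fst_le_norm (T v).snd).trans (norm_snd_le_norm (T v))
    have h7 : ‖Q v.snd.fst.fst - v.snd.snd‖ ≤ ‖T v‖ :=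
      (norm_snd_le_norm (T v).snd).trans (norm_snd_le_norm (T v))
    rw [dist_comm (P _), dist_eq_norm v.fst.fst] at h2
    have h8 := mul_le_mul_of_nonneg_left h5 K.2
    have h9 := mul_le_mul_of_nonneg_left (add_le_add h6 h7) hC
    rw [hT₀, norm_zero, mul_zero, add_zero, hcv, hcv]
    change f (P e₀) ≤ v.fst.snd + (K + 2 * C) * ‖T v‖
    have h10 : (K : ℝ) * ‖v.fst.fst - P v.snd.fst.fst‖ ≤ K * ‖T v‖ := h8
    linarith
  obtain ⟨ζ, N, hN, hinner⟩ :=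
    exists_limitingNormal_of_isLocalMinOn_add_norm hA hv₀ hT₀ (by positivity) hminA
  obtain ⟨hN1, hN2⟩ := limitingNormalCone_setProd_subset _ _ _ hN
  obtain ⟨hN3, hN4⟩ := limitingNormalCone_setProd_subset _ _ _ hN2
  refine ⟨N.fst.fst, ?_, -N.snd.fst.snd, N.snd.fst.fst, ?_, N.snd.snd, hN4, fun e => ?_⟩
  · -- Moving `t` alone does not change the penalty, so the last component of the normal is `-1`.
    have h := hinner (pair (pair 0 1) 0)
    rw [hcv, hTv] at h
    have hN' : N.fst.snd = -1 := by
      simpa [WithLp.prod_inner_apply] using h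
    change pair N.fst.fst (-1 : ℝ) ∈ limitingNormalCone (epigraph f) (pair (P e₀) (f (P e₀)))
    rw [← hN']
    exact hN1
  · change pair N.snd.fst.fst (- -N.snd.fst.snd) ∈ limitingNormalCone (gph Υ) (pair e₀ 0)
    rw [neg_neg]
    exact hN3
  · -- Along `((P e, 0), (e, 0), Q e)` both the cost and the penalty vanish.
    have h := hinner (pair (pair (P e) 0) (pair (pair e 0) (Q e)))
    rw [hcv, hTv] at h
    simpa [WithLp.prod_inner_apply, add_assoc] using h

end Composite

/-! ### The program with implicit variables -/

section Program

theorem zero_mem_singleton_sub_iff {E : Type*} [AddCommGroup E] {e : E} {A : Set E} :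
    0 ∈ ({e} : Set E) - A ↔ e ∈ A := by
  simp [Set.singleton_sub, sub_eq_zero]

theorem mem_sub_singleton_iff {E : Type*} [AddCommGroup E] {u l : E} {A : Set E} :
    u ∈ A - {l} ↔ u + l ∈ A := by
  simp [Set.sub_singleton, sub_eq_iff_eq_add]

theorem sub_mem_singleton_sub {E : Type*} [AddCommGroup E] {e a : E} {A : Set E} (ha : a ∈ A) :
    e - a ∈ ({e} : Set E) - A :=
  Set.sub_mem_sub rfl ha

theorem edist_zero_sub_eq {E : Type*} [SeminormedAddCommGroup E] (x y : E) :
    edist 0 (x - y) = edist x y := by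
  rw [edist_dist, edist_dist, dist_zero_left, dist_eq_norm]

section

variable {X L S : Type*} [NormedAddCommGroup X] [NormedAddCommGroup L] [NormedAddCommGroup S]
  {f : X → ℝ} {F : X → Set L} {G : EProd X L → Set S} {M : Set X} {z₀ : X} {l₀ : L}

theorem isClosed_gph_mapCalH (hF : IsClosed (gph F)) (hG : IsClosed (gph G)) :
    IsClosed (gph (mapCalH F G)) := by
  have h : gph (mapCalH F G) =
      (fun q : EProd (EProd X L) (EProd L S) => pair q.fst.fst (q.snd.fst + q.fst.snd)) ⁻¹' gph F ∩
      (fun q : EProd (EProd X L) (EProd L S) => pair q.fst q.snd.snd) ⁻¹' gph G := by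
    ext q
    exact and_congr_left' mem_sub_singleton_iff
  rw [h]
  exact (hF.preimage (by fun_prop)).inter (hG.preimage (by fun_prop))

/-- A local minimizer `z₀` stays one after lifting to the variables `(z, l)`. -/
theorem IsLocalMinimizer.isLocalMinOn_comp_fst (hz : IsLocalMinimizer f F G M z₀)
    {A : Set (EProd X L)} (hA : ∀ p ∈ A, p.fst ∈ feasibleSet F G M) :
    IsLocalMinOn (fun p : EProd X L => f p.fst) A (pair z₀ l₀) := by
  have hc : Continuous (WithLp.fst : EProd X L → X) := WithLp.continuous_fst 2 X L
  exact (hc.continuousWithinAt (x := pair z₀ l₀)).tendsto_nhdsWithin hA hz.2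

end

variable {X L S : Type*}
  [NormedAddCommGroup X] [InnerProductSpace ℝ X] [FiniteDimensional ℝ X]
  [NormedAddCommGroup S] [InnerProductSpace ℝ S] [FiniteDimensional ℝ S]
  {f : X → ℝ} {F : X → Set L} {G : EProd X L → Set S} {M : Set X} {z₀ : X} {l₀ : L}

theorem implicitlyMStationary_of_isLocalMinimizer (hf : LocallyLipschitz f) (hM : IsClosed M)
    (hz : IsLocalMinimizer f F G M z₀) (hH : LocallyClosedAround (gph (mapH F G)) (pair z₀ 0))
    (hsub : MetricallySubregularAt (mapHM F G M) z₀ (pair 0 0)) :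
    ImplicitlyMStationary f F G M z₀ := by
  obtain ⟨κ, -, U, hU, hκ⟩ := hsub
  obtain ⟨ξ, hξ, ν, θ, hθ, η, hη, hsum⟩ := exists_multipliers hf (ContinuousLinearMap.id ℝ X)
    (ContinuousLinearMap.id ℝ X) hH hM hz.1 hz.2 (κ := κ) (by
      filter_upwards [hU] with z hzU w hw y hy
      have h1 : svInv (mapHM F G M) (pair 0 0) ⊆ feasibleSet F G M :=
        fun z hz => ⟨hz.1, zero_mem_singleton_sub_iff.1 hz.2⟩
      refine (Metric.infEDist_anti h1).trans ((hκ z hzU).trans ?_)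
      gcongr
      refine (Metric.infEDist_le_edist_of_mem (s := mapHM F G M z) (y := pair w (z - y))
        ⟨hw, sub_mem_singleton_sub hy⟩).trans ((edist_pair_le _ _ _ _).trans_eq ?_)
      rw [edist_zero_sub_eq]
      rfl)
  have h0 : ξ + θ + η = 0 := ext_inner_right ℝ fun e => by
    simpa [inner_add_left] using hsum e
  exact ⟨hz.1, ν, h0 ▸ Set.add_mem_add (Set.add_mem_add hξ hθ) hη⟩

variable [NormedAddCommGroup L] [InnerProductSpace ℝ L] [FiniteDimensional ℝ L]

theorem fuzzilyMStationary_of_isLocalMinimizer (hf : LocallyLipschitz f) (hF : IsClosed (gph F))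
    (hG : IsClosed (gph G)) (hM : IsClosed M) (hz : IsLocalMinimizer f F G M z₀)
    (hl : l₀ ∈ mapK F G z₀)
    (hsub : MetricallySubregularAt (mapCalHM F G M) (pair z₀ l₀) (pair (pair 0 0) 0)) :
    FuzzilyMStationary f F G M z₀ l₀ := by
  obtain ⟨κ, -, U, hU, hκ⟩ := hsub
  have hmem {p : EProd X L} : 0 ∈ mapCalH F G p ↔ p.snd ∈ F p.fst ∧ 0 ∈ G p :=
    and_congr_left' (mem_sub_singleton_iff.trans (by simp))
  obtain ⟨ξ, hξ, ν, θ, hθ, η, hη, hsum⟩ := exists_multipliers (e₀ := pair z₀ l₀) hf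
    (WithLp.fstL 2 ℝ X L) (WithLp.fstL 2 ℝ X L) (Υ := mapCalH F G) (Ω := M)
    ((isClosed_gph_mapCalH hF hG).locallyClosedAround _) hM ⟨hmem.2 hl, hz.1.2⟩
    (hz.isLocalMinOn_comp_fst fun p hp =>
      ⟨Set.mem_biUnion (hmem.1 hp.1).1 (hmem.1 hp.1).2, hp.2⟩) (κ := κ) (by
      filter_upwards [hU] with p hpU w hw y hy
      have h1 : svInv (mapCalHM F G M) (pair (pair 0 0) 0) ⊆
          {p | 0 ∈ mapCalH F G p ∧ WithLp.fstL 2 ℝ X L p ∈ M} :=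
        fun p hp => ⟨hp.1, zero_mem_singleton_sub_iff.1 hp.2⟩
      refine (Metric.infEDist_anti h1).trans ((hκ p hpU).trans ?_)
      gcongr
      refine (Metric.infEDist_le_edist_of_mem (s := mapCalHM F G M p) (y := pair w (p.fst - y))
        ⟨hw, sub_mem_singleton_sub hy⟩).trans ((edist_pair_le _ _ _ _).trans_eq ?_)
      rw [edist_zero_sub_eq]
      rfl)
  have h0 : pair ξ (0 : L) + θ + pair η 0 = pair 0 0 := ext_inner_right ℝ fun e => by
    simpa [inner_add_left, WithLp.prod_inner_apply] using hsum e
  exact ⟨hz.1, hl, ν.fst, ν.snd, h0 ▸ Set.add_mem_add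
    (Set.add_mem_add (show pair ξ (0 : L) ∈ setProd _ {0} from ⟨hξ, rfl⟩) hθ)
    (show pair η (0 : L) ∈ setProd _ {0} from ⟨hη, rfl⟩)⟩

/-- Here `gph F` is treated as a geometric constraint next to `M`, that is, the multiplier rule is
applied to `0 ∈ G (z, l)` and `((z, l), z) ∈ gph F × M`. -/
theorem explicitlyMStationary_of_isLocalMinimizer (hf : LocallyLipschitz f)
    (hF : IsClosed (gph F)) (hG : IsClosed (gph G)) (hM : IsClosed M)
    (hz : IsLocalMinimizer f F G M z₀) (hl : l₀ ∈ mapK F G z₀)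
    (hsub : MetricallySubregularAt (mapFrakHM F G M) (pair z₀ l₀)
      (pair (pair (pair 0 0) (pair (pair 0 0) 0)) 0)) :
    ExplicitlyMStationary f F G M z₀ l₀ := by
  obtain ⟨κ, -, U, hU, hκ⟩ := hsub
  let Q : EProd X L →L[ℝ] EProd (EProd X L) X :=
    pairL (ContinuousLinearMap.id ℝ _) (WithLp.fstL 2 ℝ X L)
  obtain ⟨ξ, hξ, ν, θ, hθ, η, hη, hsum⟩ := exists_multipliers (e₀ := pair z₀ l₀) hf
    (WithLp.fstL 2 ℝ X L) Q (Υ := G) (Ω := setProd (gph F) M)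
    (hG.locallyClosedAround _) (isClosed_setProd hF hM) ⟨hl.2, hl.1, hz.1.2⟩
    (hz.isLocalMinOn_comp_fst fun p hp => ⟨Set.mem_biUnion hp.2.1 hp.1, hp.2.2⟩)
    (κ := κ * 2) (by
      filter_upwards [hU] with p hpU w hw y hy
      have h1 : svInv (mapFrakHM F G M) (pair (pair (pair 0 0) (pair (pair 0 0) 0)) 0) ⊆
          {p | 0 ∈ G p ∧ Q p ∈ setProd (gph F) M} :=
        fun p hp => ⟨(zero_mem_singleton_sub_iff (e := pair p (0 : S)) (A := gph G)).1 hp.1.2,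
          zero_mem_singleton_sub_iff.1 hp.1.1, zero_mem_singleton_sub_iff.1 hp.2⟩
      refine (Metric.infEDist_anti h1).trans ((hκ p hpU).trans ?_)
      rw [ENNReal.coe_mul, mul_assoc]
      gcongr
      refine (Metric.infEDist_le_edist_of_mem (s := mapFrakHM F G M p)
        (y := pair (pair (p - y.fst) (pair p 0 - pair p w)) (p.fst - y.snd))
        ⟨⟨sub_mem_singleton_sub hy.1, sub_mem_singleton_sub (show pair p w ∈ gph G from hw)⟩,
          sub_mem_singleton_sub hy.2⟩).trans ?_
      calc _ ≤ edist 0 (p - y.fst) + edist 0 (pair p 0 - pair p w) + edist 0 (p.fst - y.snd) :=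
            (edist_pair_le _ _ _ _).trans (add_le_add_left (edist_pair_le _ _ _ _) _)
        _ ≤ edist (Q p) y + edist 0 w + edist (Q p) y := by
            rw [edist_zero_sub_eq, edist_zero_sub_eq, edist_zero_sub_eq]
            gcongr
            · exact edist_fst_le (Q p) y
            · exact (edist_pair_le _ _ _ _).trans_eq (by simp)
            · exact edist_snd_le (Q p) y
        _ ≤ edist (Q p) y + edist 0 w + edist (Q p) y + edist 0 w := le_self_add
        _ = ((2 : ℝ≥0) : ℝ≥0∞) * (edist 0 w + edist (Q p) y) := by
            rw [ENNReal.coe_ofNat]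
            ring)
  obtain ⟨hη1, hη2⟩ := limitingNormalCone_setProd_subset _ _ _ hη
  have h0 : pair ξ (0 : L) + θ + η.fst + pair η.snd 0 = 0 := ext_inner_right ℝ fun e => by
    simpa [inner_add_left, WithLp.prod_inner_apply, Q, add_assoc] using hsum e
  have hX : ξ + θ.fst + η.fst.fst + η.snd = 0 := congrArg WithLp.fst h0
  have hL : θ.snd = -η.fst.snd := by
    have : 0 + θ.snd + η.fst.snd + 0 = 0 := congrArg WithLp.snd h0
    rw [zero_add, add_zero] at this
    exact eq_neg_of_add_eq_zero_left this
  refine ⟨hz.1, hl, -η.fst.snd, ν, ?_⟩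
  have hηF : η.fst.fst ∈ coderiv F z₀ l₀ (-η.fst.snd) := by
    change pair η.fst.fst (- -η.fst.snd) ∈ limitingNormalCone (gph F) (pair z₀ l₀)
    rw [neg_neg]
    exact hη1
  have hθG : θ.fst ∈ {a : X | pair a (-η.fst.snd) ∈ coderiv G (pair z₀ l₀) 0 ν} := by
    rw [← hL]
    exact hθ
  rw [← hX, add_right_comm ξ]
  exact Set.add_mem_add (Set.add_mem_add (Set.add_mem_add hξ hηF) hθG) hη2

end Program

theorem proposition4p8 (n m s : ℕ)
    (f : EuclideanSpace ℝ (Fin n) → ℝ)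
    (F : EuclideanSpace ℝ (Fin n) → Set (EuclideanSpace ℝ (Fin m)))
    (G : EProd (EuclideanSpace ℝ (Fin n)) (EuclideanSpace ℝ (Fin m)) →
      Set (EuclideanSpace ℝ (Fin s)))
    (M : Set (EuclideanSpace ℝ (Fin n)))
    (hf : LocallyLipschitz f) (hF : IsClosed (gph F)) (hG : IsClosed (gph G))
    (hM : IsClosed M)
    (zbar : EuclideanSpace ℝ (Fin n)) (hz : IsLocalMinimizer f F G M zbar) :
    (LocallyClosedAround (gph (mapH F G)) (pair zbar 0) →
      MetricallySubregularAt (mapHM F G M) zbar (pair 0 0) →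
      ImplicitlyMStationary f F G M zbar) ∧
    (∀ lbar ∈ mapK F G zbar,
      MetricallySubregularAt (mapCalHM F G M) (pair zbar lbar) (pair (pair 0 0) 0) →
      FuzzilyMStationary f F G M zbar lbar) ∧
    (∀ lbar ∈ mapK F G zbar,
      MetricallySubregularAt (mapFrakHM F G M) (pair zbar lbar)
        (pair (pair (pair 0 0) (pair (pair 0 0) 0)) 0) →
      ExplicitlyMStationary f F G M zbar lbar) := by
  exact ⟨implicitlyMStationary_of_isLocalMinimizer hf hM hz,
    fun _ hl => fuzzilyMStationary_of_isLocalMinimizer hf hF hG hM hz hl,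
    fun _ hl => explicitlyMStationary_of_isLocalMinimizer hf hF hG hM hz hl⟩
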